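/- Consider a power network with buses $1,\dots,n_b$ and branches $1,\dots,n$, where branch $b$ joins two distinct buses $i_b,j_b$; let $A\in\mathbb R^{n\times n_b}$ be its branch-bus incidence matrix and $\mathcal E$ the set of pairs of buses joined by a branch. For $Y\in\mathbb R^n$ and buses $i,j$ put $$\mathcal F_{ij}(Y)=e_i^TA^T\mathrm{diag}(Y)Ae_j\,(e_i-e_j)^T\big(A^T\mathrm{diag}(Y)A\big)^{-1^*},$$ where $M^{-1^*}$ is obtained from the nodal admittance matrix $M$ by deleting the rows and columns of the reference buses (the first bus of each connected subnetwork), inverting, and filling these rows and columns with zeros. For a parameter $s$ and line thresholds $c_b$ let $g(p,c)=0$ if $|p|\ge\sqrt{c^2+\pi/(2s)}$, $g(p,c)=1$ if $|p|\le\sqrt{c^2-\pi/(2s)}$, and $g(p,c)=\frac12\big(1-\sin s(p^2-c^2)\big)$ otherwise. Let $P^0\in\mathbb R^{n_b}$ be the original injected power, $Y^0_p$ the original branch admittances, $\delta$ a disturbance, $Y^1_p=Y^0_p+\delta$ and $(Y_p^{k+1})_b=g(\mathcal F_{i_bj_b}(Y_p^k)P^0,c_b)\,(Y_p^k)_b$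 for $k\ge1$. Fix $m\ge2$. Let $$R^{m-1}_{ij}=\sum_{b}\frac{\partial\,[\mathcal F_{ij}(Y)P^0]}{\partial Y_b}\Big|_{Y=Y_p^m}\; \frac{\partial g}{\partial p}\big(\mathcal F_{i_bj_b}(Y_p^{m-1})P^0,c_b\big)\,(Y_p^{m-1})_b\;\mathcal F_{i_bj_b}(Y_p^{m-1})^T,\qquad R^m_{ij}=\mathcal F_{ij}(Y_p^m)^T,$$ and let $\hat P^m_{ij}=(R^{m-1}_{ij})^T(P^{m-1}-P^0)+(R^m_{ij})^TP^m$ be the linearized transmission power. With weights $W\in\mathbb R^{n_b}$, thresholds $\sigma_{ij}$ and bounds $\underline P,\bar P\in\mathbb R^{n_b}$, the linearized two-step recurring problem is to minimize $$\mathcal C(P^{m-1},P^m)=\|W\circ(P^{m-1}-P^0)\|^2+\|W\circ(P^m-P^0)\|^2$$ over $P^{m-1},P^m\in\mathbb R^{n_b}$ subject to $(\hat P^m_{ij})^2\le\sigma_{ij}^2$ for $(i,j)\in\mathcal E$ and $\underline P_i\le P^k_i\le\bar P_i$ for all $i$ and $k\in\{m-1,m\}$. Its Lagrangian is $$L=\mathcal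 C+\sum_{k,i}\bar\tau^k_i(P^k_i-\bar P_i)+\sum_{k,i}\underline\tau^k_i(\underline P_i-P^k_i)+\sum_{(i,j)\in\mathcal E}\lambda_{ij}\big[(\hat P^m_{ij})^2-\sigma_{ij}^2\big],$$ and its saddle-point dynamics, on the states with $\lambda,\bar\tau,\underline\tau\ge0$, are $$\dot P^k=-\nabla_{P^k}L,\quad \dot\lambda_{ij}=\big[(\hat P^m_{ij})^2-\sigma_{ij}^2\big]^+_{\lambda_{ij}},\quad \dot{\bar\tau}^k_i=\big[P^k_i-\bar P_i\big]^+_{\bar\tau^k_i},\quad \dot{\underline\tau}^k_i=\big[\underline P_i-P^k_i\big]^+_{\underline\tau^k_i},$$ where $[x]^+_y=x$ if $y>0$ and $[x]^+_y=\max\{x,0\}$ if $y=0$. Solutions are understood in the sense of Carathéodory on $[0,\infty)$ (locally absolutely continuous, satisfying the equations at almost every time). Proposition 7. Suppose that $W_i\ne0$ for all $i$, that $\sigma_{ij}>0$ for all $(i,j)\in\mathcal E$, and that the feasible region of the problem is nonempty. Then the problem has exactly one optimal solution $P^*=(P^{m-1*},P^{m*})$, and there are multipliers $(\lambda^*,\tau^*)$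 such that $(P^*,\lambda^*,\tau^*)$ is a saddle point of $L$ (over all $P$ and all nonnegative multipliers). Every such saddle point is Lyapunov stable for the saddle-point dynamics. Every solution of the saddle-point dynamics, from any initial state with nonnegative multipliers, converges as $t\to\infty$ to some saddle point $(P^*,\lambda^*,\tau^*)$ of $L$; in particular $P^{m-1}(t)\to P^{m-1*}$ and $P^m(t)\to P^{m*}$. -/

import Mathlib

open Set Filter Topology MeasureTheory
open scoped Matrix

noncomputable section

/-- Buses `i` and `j` are joined directly when the corresponding off-diagonal entry of the nodal
admittance matrix is nonzero; the connected components of this graph are the subnetworks. -/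
def nodalGraph {nb : ℕ} (M : Matrix (Fin nb) (Fin nb) ℝ) : SimpleGraph (Fin nb) :=
  SimpleGraph.fromRel fun i j => M i j ≠ 0

/-- The first bus of each subnetwork is its reference bus (voltage angle zero). -/
def IsReferenceBus {nb : ℕ} (M : Matrix (Fin nb) (Fin nb) ℝ) (i : Fin nb) : Prop :=
  ∀ j, (nodalGraph M).Reachable i j → i ≤ j

open Classical in
/-- The inverse of a nodal admittance matrix used for the DC power flow: the rows and columns of the
reference buses are deleted, the remaining matrix (block diagonal along the subnetworks) is
inverted, and the rows and columns of the reference buses are filled with zeros.  Thus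
`starInv M *ᵥ P` is the vector of voltage angles that vanishes at the reference buses. -/
def starInv {nb : ℕ} (M : Matrix (Fin nb) (Fin nb) ℝ) : Matrix (Fin nb) (Fin nb) ℝ :=
  fun i j =>
    if h : ¬ IsReferenceBus M i ∧ ¬ IsReferenceBus M j then
      (M.submatrix (Subtype.val : {k // ¬ IsReferenceBus M k} → Fin nb)
          (Subtype.val : {k // ¬ IsReferenceBus M k} → Fin nb))⁻¹
        ⟨i, h.1⟩ ⟨j, h.2⟩
    else 0

open Classical in
/-- The smoothed line-outage function with tunable parameter `s` and line threshold `c`. -/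
def outage (s p c : ℝ) : ℝ :=
  if Real.sqrt (c ^ 2 + Real.pi / (2 * s)) ≤ |p| then 0
  else if |p| ≤ Real.sqrt (c ^ 2 - Real.pi / (2 * s)) then 1
  else (1 - Real.sin (s * (p ^ 2 - c ^ 2))) / 2

open Classical in
/-- The switching operator `[x]⁺_y` (used for `0 ≤ y`). -/
def switchPlus (x y : ℝ) : ℝ := if 0 < y then x else max x 0

/-- The data of the two-step protection problem: a power network with buses `Fin nb` and branches
`Fin n`, its original branch admittances and their initial disturbance, the parameters of the outage
model, and the data of the load shedding problem. -/
structure PowerNetwork (nb n : ℕ) where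
  /-- the two end buses of each branch -/
  src : Fin n → Fin nb
  tgt : Fin n → Fin nb
  src_ne_tgt : ∀ b, src b ≠ tgt b
  /-- original branch admittances and disturbance -/
  Y0 : Fin n → ℝ
  disturb : Fin n → ℝ
  /-- tunable parameter and line thresholds of the outage function -/
  s : ℝ
  c : Fin n → ℝ
  /-- original injected power and bus weights -/
  P0 : EuclideanSpace ℝ (Fin nb)
  W : Fin nb → ℝ
  /-- lower and upper bounds of the injected power -/
  Plo : Fin nb → ℝ
  Phi : Fin nb → ℝ
  /-- transmission power thresholds imposed at the final step -/
  thr : Fin nb → Fin nb → ℝ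

namespace PowerNetwork

variable {nb n : ℕ} (N : PowerNetwork nb n)

/-- Branch-bus incidence matrix. -/
def A : Matrix (Fin n) (Fin nb) ℝ := fun b i =>
  if i = N.src b then 1 else if i = N.tgt b then -1 else 0

/-- Nodal admittance matrix `Aᵀ diag(Y) A`. -/
def nodal (Y : Fin n → ℝ) : Matrix (Fin nb) (Fin nb) ℝ := N.Aᵀ * Matrix.diagonal Y * N.A

/-- The row vector `e_iᵀ Aᵀ diag(Y) A e_j (e_i - e_j)ᵀ (Aᵀ diag(Y) A)^{-1*}`. -/
def F (Y : Fin n → ℝ) (i j : Fin nb) : Fin nb → ℝ :=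
  N.nodal Y i j • ((Pi.single i 1 - Pi.single j 1) ᵥ* starInv (N.nodal Y))

/-- Transmission power on branch `b` for admittances `Y` and injected power `P`. -/
def branchFlow (Y : Fin n → ℝ) (P : EuclideanSpace ℝ (Fin nb)) (b : Fin n) : ℝ :=
  N.F Y (N.src b) (N.tgt b) ⬝ᵥ P.ofLp

/-- One cascading step `Y ↦ 𝒢(P_{ij}) ∘ Y` with injected power `P`. -/
def step (Y : Fin n → ℝ) (P : EuclideanSpace ℝ (Fin nb)) : Fin n → ℝ := fun b =>
  outage N.s (N.branchFlow Y P b) (N.c b) * Y b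

/-- Branch admittance at the `k`-th cascading step when the injected power stays at `P0`. -/
def Yp : ℕ → Fin n → ℝ
  | 0 => N.Y0
  | 1 => N.Y0 + N.disturb
  | k + 2 => N.step (Yp (k + 1)) N.P0

/-- The admittance `Y_p^m|_{P0} = 𝒢(ℱ(Y_p^{m-1}) P0) ∘ Y_p^{m-1}`. -/
def YmAtP0 (m : ℕ) : Fin n → ℝ := N.step (N.Yp (m - 1)) N.P0

/-- The gradients `R_{ij}^k` of the linearized transmission power; `k = 0` stands for the step
`m - 1` and `k = 1` for the step `m`.  The first one is the chain-rule expression: for each branch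
`b`, the partial derivative of `ℱ_{ij}(Y) P0` in `Y_b` at `Y_p^m|_{P0}`, times the derivative of the
outage function at the flow of `b`, times `Y_b^{m-1}`, times the row vector of the flow on `b`. -/
def R (m : ℕ) (k : Fin 2) (i j : Fin nb) : Fin nb → ℝ :=
  if k = 0 then
    ∑ b : Fin n,
      (deriv (fun y => N.F (Function.update (N.YmAtP0 m) b y) i j ⬝ᵥ N.P0.ofLp) (N.YmAtP0 m b) *
        (deriv (fun p => outage N.s p (N.c b)) (N.branchFlow (N.Yp (m - 1)) N.P0 b) *
          N.Yp (m - 1) b)) •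
        N.F (N.Yp (m - 1)) (N.src b) (N.tgt b)
  else N.F (N.YmAtP0 m) i j

/-- The decision variables: `P 0` is `P^{m-1}` and `P 1` is `P^m`. -/
abbrev Power (nb : ℕ) : Type := Fin 2 → EuclideanSpace ℝ (Fin nb)

/-- The linearized transmission power `P̂_{ij}^m` as a function of `(P^{m-1}, P^m)`. -/
def Phat (m : ℕ) (i j : Fin nb) (P : Power nb) : ℝ :=
  N.R m 0 i j ⬝ᵥ (P 0 - N.P0).ofLp + N.R m 1 i j ⬝ᵥ (P 1).ofLp

/-- The set `ℰ` of pairs of buses joined by a branch. -/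
abbrev Edge : Type := {e : Fin nb × Fin nb //
  ∃ b, (N.src b = e.1 ∧ N.tgt b = e.2) ∨ (N.src b = e.2 ∧ N.tgt b = e.1)}

/-- `‖W ∘ (P^{m-1} - P0)‖² + ‖W ∘ (P^m - P0)‖²`. -/
def cost (P : Power nb) : ℝ :=
  ∑ k, ‖WithLp.toLp 2 fun i => N.W i * (P k - N.P0) i‖ ^ 2

/-- The feasible region of the linearized two-step problem. -/
def feasible (m : ℕ) : Set (Power nb) :=
  {P | (∀ e : N.Edge, N.Phat m e.1.1 e.1.2 P ^ 2 ≤ N.thr e.1.1 e.1.2 ^ 2) ∧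
    ∀ k i, N.Plo i ≤ P k i ∧ P k i ≤ N.Phi i}

/-- Optimal solutions of the linearized two-step problem. -/
def IsOptimal (m : ℕ) (P : Power nb) : Prop :=
  P ∈ N.feasible m ∧ ∀ Q ∈ N.feasible m, N.cost P ≤ N.cost Q

/-- The multipliers `(λ, τ̄, τ̲)`. -/
abbrev Multiplier : Type :=
  (N.Edge → ℝ) × (Fin 2 → Fin nb → ℝ) × (Fin 2 → Fin nb → ℝ)

/-- The Lagrangian. -/
def lagrangian (m : ℕ) (P : Power nb) (μ : N.Multiplier) : ℝ :=
  N.cost P + ∑ k, ∑ i, μ.2.1 k i * (P k i - N.Phi i) + ∑ k, ∑ i, μ.2.2 k i * (N.Plo i - P k i) +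
    ∑ e : N.Edge, μ.1 e * (N.Phat m e.1.1 e.1.2 P ^ 2 - N.thr e.1.1 e.1.2 ^ 2)

/-- Saddle points of the Lagrangian over all powers and all nonnegative multipliers. -/
def IsSaddlePoint (m : ℕ) (P : Power nb) (μ : N.Multiplier) : Prop :=
  0 ≤ μ ∧ (∀ Q, N.lagrangian m P μ ≤ N.lagrangian m Q μ) ∧
    ∀ ν, 0 ≤ ν → N.lagrangian m P ν ≤ N.lagrangian m P μ

/-- The states of the saddle-point dynamics. -/
abbrev State : Type := Power nb × N.Multiplier

/-- The right-hand side of the saddle-point dynamics. -/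
def field (m : ℕ) (z : N.State) : N.State :=
  (fun k => -gradient (fun p => N.lagrangian m (Function.update z.1 k p) z.2) (z.1 k),
    fun e => switchPlus (N.Phat m e.1.1 e.1.2 z.1 ^ 2 - N.thr e.1.1 e.1.2 ^ 2) (z.2.1 e),
    fun k i => switchPlus (z.1 k i - N.Phi i) (z.2.2.1 k i),
    fun k i => switchPlus (N.Plo i - z.1 k i) (z.2.2.2 k i))

/-- Carathéodory solutions on `[0, ∞)` of the saddle-point dynamics (its right-hand side is
discontinuous): locally absolutely continuous curves with nonnegative multipliers that satisfy the
differential equation at almost every time. -/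
structure IsSolution (m : ℕ) (z : ℝ → N.State) : Prop where
  absCont : ∀ T, 0 ≤ T → AbsolutelyContinuousOnInterval z 0 T
  nonneg : ∀ t, 0 ≤ t → 0 ≤ (z t).2
  hasDeriv : ∀ᵐ t ∂volume, 0 < t → HasDerivAt z (N.field m (z t)) t

end PowerNetwork

end

/-- Bound for the increment of an absolutely continuous function whose derivative is almost
everywhere at most `C`. -/
theorem AbsolutelyContinuousOnInterval.sub_le_of_ae_hasDerivAt_le {u u' : ℝ → ℝ} {a b C : ℝ}
    (hab : a ≤ b) (hu : AbsolutelyContinuousOnInterval u a b)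
    (hd : ∀ᵐ t ∂volume, t ∈ Ioo a b → HasDerivAt u (u' t) t ∧ u' t ≤ C) :
    u b - u a ≤ C * (b - a) := by
  rw [← hu.integral_deriv_eq_sub]
  have h : ∫ t in a..b, deriv u t ≤ ∫ _ in a..b, C := by
    refine intervalIntegral.integral_mono_ae_restrict hab hu.intervalIntegrable_deriv
      intervalIntegrable_const ?_
    rw [← restrict_Ioo_eq_restrict_Icc]
    refine (ae_restrict_iff' measurableSet_Ioo).2 ?_
    filter_upwards [hd] with t ht htI
    rw [(ht htI).1.deriv]
    exact (ht htI).2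
  simpa [mul_comm] using h

/-- A one-sided Barbalat lemma: if `u` converges and `u' ≤ -φ` almost everywhere, with `φ`
uniformly continuous, then the limit superior of `φ` is nonpositive. -/
theorem eventually_lt_of_ae_hasDerivAt_le_neg {u u' φ : ℝ → ℝ} {l : ℝ}
    (hac : ∀ T, 0 ≤ T → AbsolutelyContinuousOnInterval u 0 T)
    (hd : ∀ᵐ t ∂volume, 0 < t → HasDerivAt u (u' t) t ∧ u' t ≤ -φ t)
    (hφ : UniformContinuousOn φ (Ici 0)) (hl : Tendsto u atTop (𝓝 l)) {ε : ℝ} (hε : 0 < ε) :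
    ∀ᶠ t in atTop, φ t < ε := by
  obtain ⟨δ, hδ, hφδ⟩ := Metric.uniformContinuousOn_iff.1 hφ (ε / 2) (by positivity)
  have hdiff : Tendsto (fun t => u (t + δ / 2) - u t) atTop (𝓝 0) := by
    simpa using (hl.comp (tendsto_atTop_add_const_right atTop (δ / 2) tendsto_id)).sub hl
  have hev := hdiff.eventually (lt_mem_nhds (show -(ε / 2 * (δ / 2)) < 0 by
    have : 0 < ε / 2 * (δ / 2) := by positivity
    linarith))
  filter_upwards [hev, eventually_ge_atTop 0] with t ht ht0
  have hb := AbsolutelyContinuousOnInterval.sub_le_of_ae_hasDerivAt_le (u := u) (u' := u')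
    (a := t) (b := t + δ / 2) (C := -φ t + ε / 2) (by linarith)
    ((hac (t + δ / 2) (by linarith)).mono (by
      rw [uIcc_of_le (by linarith), uIcc_of_le (by linarith)]
      exact Icc_subset_Icc_left ht0)) (by
      filter_upwards [hd] with s hs hsI
      have hs0 : 0 < s := lt_of_le_of_lt ht0 hsI.1
      refine ⟨(hs hs0).1, ?_⟩
      have h1 := hφδ s hs0.le t ht0 (by
        rw [Real.dist_eq, abs_of_pos (by linarith [hsI.1])]
        linarith [hsI.2])
      rw [Real.dist_eq] at h1
      linarith [(hs hs0).2, (abs_lt.1 h1).1])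
  by_contra hcon
  have : (φ t - ε) * (δ / 2) ≥ 0 := mul_nonneg (by linarith) (by linarith)
  nlinarith

/-- Absolute continuity is preserved by Lipschitz maps. -/
theorem AbsolutelyContinuousOnInterval.lipschitz_comp {X Y : Type*} [PseudoMetricSpace X]
    [PseudoMetricSpace Y] {f : ℝ → X} {φ : X → Y} {K : NNReal} {a b : ℝ}
    (hφ : LipschitzWith K φ) (hf : AbsolutelyContinuousOnInterval f a b) :
    AbsolutelyContinuousOnInterval (fun t => φ (f t)) a b := by
  refine squeeze_zero (fun E => Finset.sum_nonneg fun i _ => dist_nonneg) (fun E => ?_)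
    (by simpa using Tendsto.const_mul (K : ℝ) hf)
  rw [Finset.mul_sum]
  exact Finset.sum_le_sum fun i _ => hφ.dist_le_mul _ _

theorem AbsolutelyContinuousOnInterval.finset_sum {κ : Type*} {u : κ → ℝ → ℝ} {a b : ℝ}
    (s : Finset κ) (h : ∀ k ∈ s, AbsolutelyContinuousOnInterval (u k) a b) :
    AbsolutelyContinuousOnInterval (fun t => ∑ k ∈ s, u k t) a b := by
  classical
  induction s using Finset.induction_on with
  | empty =>
    simpa using (LipschitzWith.const (0 : ℝ)).lipschitzOnWith.absolutelyContinuousOnInterval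
  | insert k s hk ih =>
    have := (h k (by simp)).add (ih fun l hl => h l (by simp [hl]))
    simp only [Finset.sum_insert hk]
    exact this

/-- **Farkas' lemma** for finitely many linear functionals. -/
theorem exists_nonneg_eq_sum_smul_of_forall_nonpos {V κ : Type*} [AddCommGroup V] [Module ℝ V]
    (s : Finset κ) (a : κ → V →ₗ[ℝ] ℝ) (v : V →ₗ[ℝ] ℝ)
    (h : ∀ d, (∀ k ∈ s, a k d ≤ 0) → v d ≤ 0) :
    ∃ μ : κ → ℝ, (∀ k, 0 ≤ μ k) ∧ v = ∑ k ∈ s, μ k • a k := by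
  classical
  induction s using Finset.induction_on generalizing a v with
  | empty =>
    refine ⟨0, fun _ => le_rfl, ?_⟩
    ext d
    have h1 := h d (by simp)
    have h2 := h (-d) (by simp)
    rw [map_neg] at h2
    simp
    linarith
  | insert k₀ s hk₀ ih =>
    have hne : ∀ k ∈ s, k ≠ k₀ := by
      rintro k hk rfl
      exact hk₀ hk
    by_cases hs : ∀ d, (∀ k ∈ s, a k d ≤ 0) → v d ≤ 0
    · obtain ⟨μ, hμ, hv⟩ := ih a v hs
      refine ⟨Function.update μ k₀ 0, fun k => ?_, ?_⟩
      · by_cases hk : k = k₀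
        · simp [hk]
        · simp [hk, hμ k]
      · rw [Finset.sum_insert hk₀, hv]
        simp only [Function.update_self, zero_smul, zero_add]
        refine Finset.sum_congr rfl fun k hk => ?_
        rw [Function.update_of_ne (hne k hk)]
    · push Not at hs
      obtain ⟨d, hd, hvd⟩ := hs
      have hpos : 0 < a k₀ d := by
        by_contra hcon
        refine absurd (h d fun k hk => ?_) (not_le.2 hvd)
        rcases Finset.mem_insert.1 hk with rfl | hk
        · exact not_lt.1 hcon
        · exact hd k hk
      obtain ⟨μ, hμ, hv⟩ := ih (fun k => a k - (a k d / a k₀ d) • a k₀)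
        (v - (v d / a k₀ d) • a k₀) (fun x hx => by
          have := h (x - (a k₀ x / a k₀ d) • d) (fun k hk => by
            rcases Finset.mem_insert.1 hk with rfl | hk
            · simp [hpos.ne']
            · have := hx k hk
              simp only [LinearMap.sub_apply, LinearMap.smul_apply, smul_eq_mul, map_sub,
                map_smul] at this ⊢
              convert this using 2
              ring)
          simp only [LinearMap.sub_apply, LinearMap.smul_apply, smul_eq_mul, map_sub,
            map_smul] at this ⊢
          convert this using 2
          ring)
      refine ⟨Function.update μ k₀ (v d / a k₀ d - ∑ k ∈ s, μ k * (a k d / a k₀ d)),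
        fun k => ?_, ?_⟩
      · by_cases hk : k = k₀
        · subst hk
          rw [Function.update_self, sub_nonneg]
          refine (Finset.sum_nonpos fun l hl => ?_).trans (by positivity)
          exact mul_nonpos_of_nonneg_of_nonpos (hμ l)
            (div_nonpos_of_nonpos_of_nonneg (hd l hl) hpos.le)
        · simp [hk, hμ k]
      · rw [Finset.sum_insert hk₀, Function.update_self,
          Finset.sum_congr rfl (fun k hk => by
            rw [Function.update_of_ne (hne k hk)] :
              ∀ k ∈ s, Function.update μ k₀ _ k • a k = μ k • a k)]
        refine (eq_add_of_sub_eq hv).trans ?_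
        ext x
        simp only [LinearMap.add_apply, LinearMap.sum_apply, LinearMap.smul_apply,
          LinearMap.sub_apply, smul_eq_mul, mul_sub, sub_mul, Finset.sum_sub_distrib,
          Finset.sum_mul, mul_assoc]
        ring

theorem switchPlus_abs_le {x y : ℝ} : |switchPlus x y| ≤ |x| := by
  unfold switchPlus
  split_ifs
  · exact le_rfl
  · rcases le_total x 0 with h | h <;> simp [h]

theorem switchPlus_nonpos {x y : ℝ} (hx : x ≤ 0) : switchPlus x y ≤ 0 := by
  unfold switchPlus
  split_ifs
  · exact hx
  · simp [hx]

theorem sub_mul_switchPlus_le {x y z : ℝ} (hy : 0 ≤ y) (hz : 0 ≤ z) :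
    (y - z) * switchPlus x y ≤ (y - z) * x := by
  unfold switchPlus
  split_ifs with h
  · exact le_rfl
  · obtain rfl : y = 0 := le_antisymm (not_lt.1 h) hy
    nlinarith [le_max_left x 0]

/-- A strongly convex objective and finitely many convex constraints `g j ≤ 0`, with continuous
gradients, convexity being expressed by the first-order inequalities. -/
structure ConvexProgram (ι J : Type*) [Fintype ι] where
  /-- objective -/
  f : (ι → ℝ) → ℝ
  /-- gradient of the objective -/
  df : (ι → ℝ) → ι → ℝ
  /-- constraint functions -/
  g : J → (ι → ℝ) → ℝ
  /-- gradients of the constraint functions -/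
  dg : J → (ι → ℝ) → ι → ℝ
  /-- modulus of strong convexity -/
  modulus : ℝ
  modulus_pos : 0 < modulus
  f_convex : ∀ x x', f x + ∑ i, df x i * (x' i - x i) + modulus * ∑ i, (x' i - x i) ^ 2 ≤ f x'
  g_convex : ∀ j x x', g j x + ∑ i, dg j x i * (x' i - x i) ≤ g j x'
  continuous_df : ∀ i, Continuous fun x => df x i
  continuous_g : ∀ j, Continuous (g j)
  continuous_dg : ∀ j i, Continuous fun x => dg j x i

namespace ConvexProgram

variable {ι J : Type*} [Fintype ι] [Fintype J] (C : ConvexProgram ι J)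

/-- The Lagrangian. -/
def L (x : ι → ℝ) (y : J → ℝ) : ℝ := C.f x + ∑ j, y j * C.g j x

/-- Gradient of the Lagrangian in the primal variable. -/
def dL (x : ι → ℝ) (y : J → ℝ) (i : ι) : ℝ := C.df x i + ∑ j, y j * C.dg j x i

/-- Saddle points of the Lagrangian over nonnegative multipliers. -/
structure IsSaddle (x : ι → ℝ) (y : J → ℝ) : Prop where
  nonneg : ∀ j, 0 ≤ y j
  min : ∀ x', C.L x y ≤ C.L x' y
  max : ∀ y', (∀ j, 0 ≤ y' j) → C.L x y' ≤ C.L x y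

/-- The Karush-Kuhn-Tucker conditions. -/
structure IsKKT (x : ι → ℝ) (y : J → ℝ) : Prop where
  nonneg : ∀ j, 0 ≤ y j
  stationary : ∀ i, C.dL x y i = 0
  feasible : ∀ j, C.g j x ≤ 0
  complementary : ∀ j, y j * C.g j x = 0

/-- Carathéodory solutions of the saddle-point dynamics. -/
structure IsTrajectory (x : ℝ → ι → ℝ) (y : ℝ → J → ℝ) : Prop where
  absCont_primal : ∀ i T, 0 ≤ T → AbsolutelyContinuousOnInterval (fun t => x t i) 0 T
  absCont_dual : ∀ j T, 0 ≤ T → AbsolutelyContinuousOnInterval (fun t => y t j) 0 T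
  nonneg : ∀ t, 0 ≤ t → ∀ j, 0 ≤ y t j
  hasDeriv_primal : ∀ i, ∀ᵐ t ∂volume, 0 < t →
    HasDerivAt (fun t => x t i) (-C.dL (x t) (y t) i) t
  hasDeriv_dual : ∀ j, ∀ᵐ t ∂volume, 0 < t →
    HasDerivAt (fun t => y t j) (switchPlus (C.g j (x t)) (y t j)) t

/-- Squared Euclidean distance of `(x, y)` from `(xs, ys)`. -/
def sqDist (xs : ι → ℝ) (ys : J → ℝ) (x : ι → ℝ) (y : J → ℝ) : ℝ :=
  ∑ i, (x i - xs i) ^ 2 + ∑ j, (y j - ys j) ^ 2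

theorem L_convex (x x' : ι → ℝ) {y : J → ℝ} (hy : ∀ j, 0 ≤ y j) :
    C.L x y + ∑ i, C.dL x y i * (x' i - x i) + C.modulus * ∑ i, (x' i - x i) ^ 2 ≤ C.L x' y := by
  have h1 := C.f_convex x x'
  have h2 : ∑ j, y j * (C.g j x + ∑ i, C.dg j x i * (x' i - x i)) ≤ ∑ j, y j * C.g j x' :=
    Finset.sum_le_sum fun j _ => mul_le_mul_of_nonneg_left (C.g_convex j x x') (hy j)
  have h3 : ∑ i, C.dL x y i * (x' i - x i) = ∑ i, C.df x i * (x' i - x i) +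
      ∑ j, y j * ∑ i, C.dg j x i * (x' i - x i) := by
    simp only [dL, add_mul, Finset.sum_add_distrib, Finset.sum_mul, Finset.mul_sum]
    rw [Finset.sum_comm]
    simp only [mul_assoc]
  simp only [mul_add, Finset.sum_add_distrib] at h2
  unfold L
  linarith

variable {C}

theorem IsKKT.add_modulus_le {x : ι → ℝ} {y : J → ℝ} (h : C.IsKKT x y) (x' : ι → ℝ) :
    C.L x y + C.modulus * ∑ i, (x' i - x i) ^ 2 ≤ C.L x' y := by
  simpa [h.stationary] using C.L_convex x x' h.nonneg

theorem IsKKT.isSaddle {x : ι → ℝ} {y : J → ℝ} (h : C.IsKKT x y) : C.IsSaddle x y where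
  nonneg := h.nonneg
  min x' := by
    have := h.add_modulus_le x'
    have : 0 ≤ C.modulus * ∑ i, (x' i - x i) ^ 2 :=
      mul_nonneg C.modulus_pos.le (Finset.sum_nonneg fun _ _ => sq_nonneg _)
    linarith
  max y' hy' := by
    unfold L
    rw [Finset.sum_congr rfl fun j _ => h.complementary j]
    gcongr with j
    exact mul_nonpos_of_nonneg_of_nonpos (hy' j) (h.feasible j)

/-- The primal part of a KKT point is the only minimizer on the feasible region. -/
theorem IsKKT.eq_of_le {x : ι → ℝ} {y : J → ℝ} (h : C.IsKKT x y) {x' : ι → ℝ}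
    (hx' : ∀ j, C.g j x' ≤ 0) (hle : C.f x' ≤ C.f x) : x' = x := by
  have h1 := h.add_modulus_le x'
  unfold L at h1
  rw [Finset.sum_congr rfl fun j _ => h.complementary j] at h1
  have h2 : ∑ j, y j * C.g j x' ≤ 0 :=
    Finset.sum_nonpos fun j _ => mul_nonpos_of_nonneg_of_nonpos (h.nonneg j) (hx' j)
  have h3 : ∑ i, (x' i - x i) ^ 2 ≤ 0 := by
    have : C.modulus * ∑ i, (x' i - x i) ^ 2 ≤ 0 := by
      simp only [Finset.sum_const_zero] at h1
      linarith
    exact nonpos_of_mul_nonpos_right this C.modulus_pos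
  have h4 := (Finset.sum_eq_zero_iff_of_nonneg fun i _ => sq_nonneg (x' i - x i)).1
    (le_antisymm h3 (Finset.sum_nonneg fun _ _ => sq_nonneg _))
  funext i
  have := h4 i (Finset.mem_univ i)
  nlinarith [pow_eq_zero_iff (n := 2) (by norm_num) |>.1 this]

/-- Existence of multipliers at a minimizer at which the linearized active constraints describe
feasible directions. -/
theorem exists_isKKT {x : ι → ℝ} (hx : ∀ j, C.g j x ≤ 0)
    (hmin : ∀ x', (∀ j, C.g j x' ≤ 0) → C.f x ≤ C.f x')
    (hdir : ∀ j, C.g j x = 0 → ∀ d : ι → ℝ, ∑ i, C.dg j x i * d i ≤ 0 →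
      ∀ᶠ t in 𝓝[>] (0 : ℝ), C.g j (fun i => x i + t * d i) ≤ 0) :
    ∃ y, C.IsKKT x y := by
  classical
  have hline : ∀ d : ι → ℝ, Continuous fun t : ℝ => fun i => x i + t * d i := by
    intro d
    fun_prop
  let lin : (ι → ℝ) → ((ι → ℝ) →ₗ[ℝ] ℝ) := fun a => ∑ i, a i • LinearMap.proj i
  have hlin : ∀ a d, lin a d = ∑ i, a i * d i := by
    intro a d
    simp [lin]
  obtain ⟨μ, hμ, hsum⟩ := exists_nonneg_eq_sum_smul_of_forall_nonpos
    (Finset.univ.filter fun j => C.g j x = 0) (fun j => lin (C.dg j x)) (-lin (C.df x))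
    (fun d hd => by
      have hfeas : ∀ᶠ t in 𝓝[>] (0 : ℝ), ∀ j, C.g j (fun i => x i + t * d i) ≤ 0 := by
        rw [eventually_all]
        intro j
        rcases (hx j).lt_or_eq with h | h
        · have hc : Tendsto (fun t : ℝ => C.g j fun i => x i + t * d i) (𝓝 0) (𝓝 (C.g j x)) := by
            simpa [Function.comp_def] using ((C.continuous_g j).comp (hline d)).tendsto 0
          exact ((hc.eventually (gt_mem_nhds h)).filter_mono nhdsWithin_le_nhds).mono
            fun t ht => ht.le
        · refine hdir j h d ?_
          rw [← hlin]
          exact hd j (by simp [h])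
      have hnn : ∀ᶠ t in 𝓝[>] (0 : ℝ), 0 ≤ ∑ i, C.df (fun i => x i + t * d i) i * d i := by
        filter_upwards [hfeas, self_mem_nhdsWithin] with t ht ht0
        have h1 := C.f_convex (fun i => x i + t * d i) x
        have h2 := hmin _ ht
        have h3 : 0 ≤ C.modulus * ∑ i, (x i - (x i + t * d i)) ^ 2 :=
          mul_nonneg C.modulus_pos.le (Finset.sum_nonneg fun _ _ => sq_nonneg _)
        have h4 : ∑ i, C.df (fun i => x i + t * d i) i * (x i - (x i + t * d i)) =
            -(t * ∑ i, C.df (fun i => x i + t * d i) i * d i) := by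
          rw [Finset.mul_sum, ← Finset.sum_neg_distrib]
          exact Finset.sum_congr rfl fun i _ => by ring
        exact nonneg_of_mul_nonneg_right (by linarith : 0 ≤ t * _) ht0
      have hc : Tendsto (fun t : ℝ => ∑ i, C.df (fun i => x i + t * d i) i * d i) (𝓝[>] 0)
          (𝓝 (∑ i, C.df x i * d i)) := by
        refine Tendsto.mono_left ?_ nhdsWithin_le_nhds
        have : Continuous fun t : ℝ => ∑ i, C.df (fun i => x i + t * d i) i * d i :=
          continuous_finsetSum _ fun i _ =>
            ((C.continuous_df i).comp (hline d)).mul continuous_const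
        simpa using this.tendsto 0
      have := ge_of_tendsto hc hnn
      rw [LinearMap.neg_apply, hlin]
      linarith)
  refine ⟨fun j => if C.g j x = 0 then μ j else 0, fun j => ?_, fun i => ?_, hx, fun j => ?_⟩
  · split_ifs
    exacts [hμ j, le_rfl]
  · have h := congrArg (fun φ : (ι → ℝ) →ₗ[ℝ] ℝ => φ (Pi.single i 1)) hsum
    simp only [LinearMap.neg_apply, LinearMap.sum_apply, LinearMap.smul_apply, hlin,
      smul_eq_mul, Pi.single_apply, mul_ite, mul_one, mul_zero, Finset.sum_ite_eq',
      Finset.mem_univ, if_true] at h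
    simp only [dL, ite_mul, zero_mul, ← Finset.sum_filter]
    linarith
  · split_ifs with h
    · simp [h]
    · simp

/-- Decay of the squared distance to a saddle point along the dynamics. -/
theorem IsSaddle.inner_le {xs x : ι → ℝ} {ys y : J → ℝ} (h : C.IsSaddle xs ys)
    (hy : ∀ j, 0 ≤ y j) :
    ∑ i, (x i - xs i) * -C.dL x y i + ∑ j, (y j - ys j) * switchPlus (C.g j x) (y j) ≤
      -(C.modulus * ∑ i, (x i - xs i) ^ 2) := by
  have h1 := C.L_convex x xs hy
  have h2 : ∑ j, (y j - ys j) * switchPlus (C.g j x) (y j) ≤ C.L x y - C.L x ys := by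
    have : C.L x y - C.L x ys = ∑ j, (y j - ys j) * C.g j x := by
      simp only [L, sub_mul, Finset.sum_sub_distrib]
      ring
    rw [this]
    exact Finset.sum_le_sum fun j _ => sub_mul_switchPlus_le (hy j) (h.nonneg j)
  have h3 := h.max y hy
  have h4 := h.min x
  have h5 : ∑ i, (x i - xs i) * -C.dL x y i = ∑ i, C.dL x y i * (xs i - x i) :=
    Finset.sum_congr rfl fun i _ => by ring
  have h6 : ∑ i, (xs i - x i) ^ 2 = ∑ i, (x i - xs i) ^ 2 :=
    Finset.sum_congr rfl fun i _ => by ring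
  rw [h6] at h1
  linarith

section Trajectory

variable {x : ℝ → ι → ℝ} {y : ℝ → J → ℝ} {xs : ι → ℝ} {ys : J → ℝ}

theorem IsTrajectory.absCont_sqDist (h : C.IsTrajectory x y) (xs : ι → ℝ) (ys : J → ℝ) {T : ℝ}
    (hT : 0 ≤ T) :
    AbsolutelyContinuousOnInterval (fun t => sqDist xs ys (x t) (y t)) 0 T := by
  have key : ∀ (u : ℝ → ℝ) (a : ℝ), AbsolutelyContinuousOnInterval u 0 T →
      AbsolutelyContinuousOnInterval (fun t => (u t - a) ^ 2) 0 T := by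
    intro u a hu
    have h1 : AbsolutelyContinuousOnInterval (fun t => u t - a) 0 T :=
      hu.lipschitz_comp (LipschitzWith.of_dist_le_mul (K := 1) (f := fun r : ℝ => r - a) (by simp))
    simpa only [pow_two] using h1.fun_mul h1
  exact (AbsolutelyContinuousOnInterval.finset_sum _ fun i _ =>
    key _ _ (h.absCont_primal i T hT)).add
    (AbsolutelyContinuousOnInterval.finset_sum _ fun j _ => key _ _ (h.absCont_dual j T hT))

theorem IsTrajectory.hasDeriv_sqDist (h : C.IsTrajectory x y) (hs : C.IsSaddle xs ys) :
    ∀ᵐ t ∂volume, 0 < t → HasDerivAt (fun t => sqDist xs ys (x t) (y t))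
      (2 * (∑ i, (x t i - xs i) * -C.dL (x t) (y t) i +
        ∑ j, (y t j - ys j) * switchPlus (C.g j (x t)) (y t j))) t ∧
      2 * (∑ i, (x t i - xs i) * -C.dL (x t) (y t) i +
        ∑ j, (y t j - ys j) * switchPlus (C.g j (x t)) (y t j)) ≤
      -(2 * C.modulus * ∑ i, (x t i - xs i) ^ 2) := by
  filter_upwards [ae_all_iff.2 h.hasDeriv_primal, ae_all_iff.2 h.hasDeriv_dual] with t hx hy ht
  refine ⟨?_, by linarith [hs.inner_le (x := x t) (h.nonneg t ht.le)]⟩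
  have h1 : HasDerivAt (fun t => ∑ i, (x t i - xs i) ^ 2)
      (∑ i, 2 * ((x t i - xs i) * -C.dL (x t) (y t) i)) t := by
    refine HasDerivAt.fun_sum fun i _ => ?_
    refine (((hx i ht).sub_const (xs i)).fun_pow 2).congr_deriv ?_
    norm_num
    ring
  have h2 : HasDerivAt (fun t => ∑ j, (y t j - ys j) ^ 2)
      (∑ j, 2 * ((y t j - ys j) * switchPlus (C.g j (x t)) (y t j))) t := by
    refine HasDerivAt.fun_sum fun j _ => ?_
    refine (((hy j ht).sub_const (ys j)).fun_pow 2).congr_deriv ?_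
    norm_num
    ring
  rw [mul_add, Finset.mul_sum, Finset.mul_sum]
  exact h1.add h2

/-- The squared distance to a saddle point is nonincreasing. -/
theorem IsTrajectory.sqDist_le (h : C.IsTrajectory x y) (hs : C.IsSaddle xs ys) {a b : ℝ}
    (ha : 0 ≤ a) (hab : a ≤ b) :
    sqDist xs ys (x b) (y b) ≤ sqDist xs ys (x a) (y a) := by
  have := AbsolutelyContinuousOnInterval.sub_le_of_ae_hasDerivAt_le (C := 0) hab
    ((h.absCont_sqDist xs ys (ha.trans hab)).mono (by
      rw [uIcc_of_le hab, uIcc_of_le (ha.trans hab)]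
      exact Icc_subset_Icc_left ha)) (by
      filter_upwards [h.hasDeriv_sqDist hs] with t ht htI
      have ht' := ht (ha.trans_lt htI.1)
      refine ⟨ht'.1, ht'.2.trans ?_⟩
      have : 0 ≤ 2 * C.modulus * ∑ i, (x t i - xs i) ^ 2 :=
        mul_nonneg (by linarith [C.modulus_pos]) (Finset.sum_nonneg fun _ _ => sq_nonneg _)
      linarith)
  linarith

end Trajectory

theorem sqDist_nonneg (xs : ι → ℝ) (ys : J → ℝ) (x : ι → ℝ) (y : J → ℝ) :
    0 ≤ sqDist xs ys x y :=
  add_nonneg (Finset.sum_nonneg fun _ _ => sq_nonneg _) (Finset.sum_nonneg fun _ _ => sq_nonneg _)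

theorem sq_sub_le_sqDist_left (xs : ι → ℝ) (ys : J → ℝ) (x : ι → ℝ) (y : J → ℝ) (i : ι) :
    (x i - xs i) ^ 2 ≤ sqDist xs ys x y :=
  (Finset.single_le_sum (f := fun i => (x i - xs i) ^ 2) (fun _ _ => sq_nonneg _)
    (Finset.mem_univ i)).trans
    (le_add_of_nonneg_right (Finset.sum_nonneg fun _ _ => sq_nonneg _))

theorem sq_sub_le_sqDist_right (xs : ι → ℝ) (ys : J → ℝ) (x : ι → ℝ) (y : J → ℝ) (j : J) :
    (y j - ys j) ^ 2 ≤ sqDist xs ys x y :=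
  (Finset.single_le_sum (f := fun j => (y j - ys j) ^ 2) (fun _ _ => sq_nonneg _)
    (Finset.mem_univ j)).trans
    (le_add_of_nonneg_left (Finset.sum_nonneg fun _ _ => sq_nonneg _))

theorem mem_closedBall_of_sqDist_le {xs x : ι → ℝ} {ys y : J → ℝ} {r : ℝ}
    (h : sqDist xs ys x y ≤ r) : (x, y) ∈ Metric.closedBall (xs, ys) (√r) := by
  rw [Metric.mem_closedBall, Prod.dist_eq]
  refine max_le ((dist_pi_le_iff (Real.sqrt_nonneg r)).2 fun i => ?_)
    ((dist_pi_le_iff (Real.sqrt_nonneg r)).2 fun j => ?_)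
  · exact Real.abs_le_sqrt ((sq_sub_le_sqDist_left xs ys x y i).trans h)
  · exact Real.abs_le_sqrt ((sq_sub_le_sqDist_right xs ys x y j).trans h)

theorem continuous_sqDist (xs : ι → ℝ) (ys : J → ℝ) :
    Continuous fun z : (ι → ℝ) × (J → ℝ) => sqDist xs ys z.1 z.2 := by
  unfold sqDist
  fun_prop

theorem continuous_dL (i : ι) : Continuous fun z : (ι → ℝ) × (J → ℝ) => C.dL z.1 z.2 i := by
  have h1 := C.continuous_df i
  have h2 := fun j => C.continuous_dg j i
  unfold dL
  fun_prop

end ConvexProgram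

namespace ConvexProgram

variable {ι J : Type*} [Fintype ι] [Fintype J] {C : ConvexProgram ι J}
  {x : ℝ → ι → ℝ} {y : ℝ → J → ℝ} {xs : ι → ℝ} {ys : J → ℝ}

theorem IsTrajectory.mem_closedBall (h : C.IsTrajectory x y) (hs : C.IsSaddle xs ys) {t : ℝ}
    (ht : 0 ≤ t) :
    (x t, y t) ∈ Metric.closedBall (xs, ys) (√(sqDist xs ys (x 0) (y 0))) :=
  mem_closedBall_of_sqDist_le (h.sqDist_le hs le_rfl ht)

/-- Trajectories are Lipschitz continuous. -/
theorem IsTrajectory.uniformContinuousOn (h : C.IsTrajectory x y) (hs : C.IsSaddle xs ys) :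
    UniformContinuousOn (fun t => (x t, y t)) (Ici 0) := by
  let ψ : (ι → ℝ) × (J → ℝ) → ℝ := fun z => ∑ i, |C.dL z.1 z.2 i| + ∑ j, |C.g j z.1|
  have hψ : Continuous ψ := by
    have h1 := fun i => continuous_dL (C := C) i
    have h2 := C.continuous_g
    fun_prop
  obtain ⟨B, hB⟩ := (isCompact_closedBall (xs, ys)
    (√(sqDist xs ys (x 0) (y 0)))).exists_bound_of_continuousOn hψ.continuousOn
  have hBt : ∀ t, 0 ≤ t → ψ (x t, y t) ≤ B := fun t ht =>
    (le_abs_self _).trans (hB _ (h.mem_closedBall hs ht))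
  have hdL : ∀ t, 0 ≤ t → ∀ i, |C.dL (x t) (y t) i| ≤ B := fun t ht i =>
    ((Finset.single_le_sum (f := fun i => |C.dL (x t) (y t) i|) (fun _ _ => abs_nonneg _)
      (Finset.mem_univ i)).trans
      (le_add_of_nonneg_right (Finset.sum_nonneg fun _ _ => abs_nonneg _))).trans (hBt t ht)
  have hg : ∀ t, 0 ≤ t → ∀ j, |switchPlus (C.g j (x t)) (y t j)| ≤ B := fun t ht j =>
    switchPlus_abs_le.trans (((Finset.single_le_sum (f := fun j => |C.g j (x t)|)
      (fun _ _ => abs_nonneg _) (Finset.mem_univ j)).trans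
      (le_add_of_nonneg_left (Finset.sum_nonneg fun _ _ => abs_nonneg _))).trans (hBt t ht))
  have hB0 : 0 ≤ B := le_trans (by positivity) (hBt 0 le_rfl)
  have key : ∀ u u' : ℝ → ℝ, (∀ T, 0 ≤ T → AbsolutelyContinuousOnInterval u 0 T) →
      (∀ᵐ t ∂volume, 0 < t → HasDerivAt u (u' t) t) → (∀ t, 0 ≤ t → |u' t| ≤ B) →
      ∀ s, 0 ≤ s → ∀ t, 0 ≤ t → dist (u s) (u t) ≤ B * dist s t := by
    intro u u' hac hd hu' s hs0 t ht0
    wlog hst : s ≤ t generalizing s t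
    · rw [dist_comm, dist_comm s]
      exact this t ht0 s hs0 (le_of_not_ge hst)
    have hac' : AbsolutelyContinuousOnInterval u s t := (hac t ht0).mono (by
      rw [uIcc_of_le hst, uIcc_of_le ht0]
      exact Icc_subset_Icc_left hs0)
    have h1 := hac'.sub_le_of_ae_hasDerivAt_le (u' := u') (C := B) hst (by
      filter_upwards [hd] with r hr hrI
      have hr0 := hs0.trans_lt hrI.1
      exact ⟨hr hr0, (abs_le.1 (hu' r hr0.le)).2⟩)
    have h2 := hac'.neg.sub_le_of_ae_hasDerivAt_le (u' := fun r => -u' r) (C := B) hst (by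
      filter_upwards [hd] with r hr hrI
      have hr0 := hs0.trans_lt hrI.1
      exact ⟨(hr hr0).neg, by linarith [(abs_le.1 (hu' r hr0.le)).1]⟩)
    simp only [Pi.neg_apply] at h2
    rw [Real.dist_eq, Real.dist_eq, abs_sub_comm s t, abs_of_nonneg (sub_nonneg.2 hst), abs_le]
    constructor <;> linarith
  have hlip : LipschitzOnWith B.toNNReal (fun t => (x t, y t)) (Ici 0) := by
    refine LipschitzOnWith.of_dist_le_mul fun s hs0 t ht0 => ?_
    have hnn : 0 ≤ B * dist s t := mul_nonneg hB0 dist_nonneg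
    rw [Real.coe_toNNReal B hB0, Prod.dist_eq]
    refine max_le ((dist_pi_le_iff hnn).2 fun i => ?_) ((dist_pi_le_iff hnn).2 fun j => ?_)
    · exact key _ _ (h.absCont_primal i) (h.hasDeriv_primal i)
        (fun t ht => by simpa using hdL t ht i) s hs0 t ht0
    · exact key _ _ (h.absCont_dual j) (h.hasDeriv_dual j) (fun t ht => hg t ht j) s hs0 t ht0
  exact hlip.uniformContinuousOn

theorem IsTrajectory.uniformContinuousOn_comp (h : C.IsTrajectory x y) (hs : C.IsSaddle xs ys)
    {ψ : (ι → ℝ) × (J → ℝ) → ℝ} (hψ : Continuous ψ) :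
    UniformContinuousOn (fun t => ψ (x t, y t)) (Ici 0) :=
  ((isCompact_closedBall (xs, ys)
    (√(sqDist xs ys (x 0) (y 0)))).uniformContinuousOn_of_continuous hψ.continuousOn).comp
    (h.uniformContinuousOn hs) fun _ ht => h.mem_closedBall hs ht

theorem IsTrajectory.exists_tendsto_sqDist (h : C.IsTrajectory x y) (hs : C.IsSaddle xs ys) :
    ∃ l, Tendsto (fun t => sqDist xs ys (x t) (y t)) atTop (𝓝 l) := by
  have hanti : Antitone fun t => sqDist xs ys (x (max t 0)) (y (max t 0)) := fun a b hab =>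
    h.sqDist_le hs (le_max_right a 0) (max_le_max_right 0 hab)
  refine ⟨_, (tendsto_atTop_ciInf hanti ⟨0, ?_⟩).congr' ?_⟩
  · rintro _ ⟨t, rfl⟩
    exact sqDist_nonneg _ _ _ _
  · filter_upwards [eventually_ge_atTop 0] with t ht
    rw [max_eq_left ht]

/-- The primal part of a trajectory converges. -/
theorem IsTrajectory.tendsto_primal (h : C.IsTrajectory x y) (hs : C.IsSaddle xs ys) :
    Tendsto x atTop (𝓝 xs) := by
  obtain ⟨l, hl⟩ := h.exists_tendsto_sqDist hs
  rw [tendsto_pi_nhds]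
  intro i
  rw [Metric.tendsto_nhds]
  intro ε hε
  have hc := C.modulus_pos
  have hφ : UniformContinuousOn (fun t => 2 * C.modulus * ∑ i, (x t i - xs i) ^ 2) (Ici 0) :=
    h.uniformContinuousOn_comp hs
      (ψ := fun z => 2 * C.modulus * ∑ i, (z.1 i - xs i) ^ 2) (by fun_prop)
  filter_upwards [eventually_lt_of_ae_hasDerivAt_le_neg
    (fun T hT => h.absCont_sqDist xs ys hT) (h.hasDeriv_sqDist hs) hφ hl
    (ε := 2 * C.modulus * ε ^ 2) (by positivity)] with t ht
  rw [Real.dist_eq]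
  refine abs_lt_of_sq_lt_sq ?_ hε.le
  exact (Finset.single_le_sum (f := fun i => (x t i - xs i) ^ 2) (fun _ _ => sq_nonneg _)
    (Finset.mem_univ i)).trans_lt (lt_of_mul_lt_mul_left ht (by positivity))

/-- The primal gradient of the Lagrangian vanishes asymptotically along a trajectory. -/
theorem IsTrajectory.tendsto_dL (h : C.IsTrajectory x y) (hs : C.IsSaddle xs ys) (i : ι) :
    Tendsto (fun t => C.dL (x t) (y t) i) atTop (𝓝 0) := by
  have hx := tendsto_pi_nhds.1 (h.tendsto_primal hs) i
  have hφ : UniformContinuousOn (fun t => C.dL (x t) (y t) i) (Ici 0) :=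
    h.uniformContinuousOn_comp hs (continuous_dL i)
  rw [Metric.tendsto_nhds]
  intro ε hε
  filter_upwards [eventually_lt_of_ae_hasDerivAt_le_neg (h.absCont_primal i)
      ((h.hasDeriv_primal i).mono fun t ht ht0 => ⟨ht ht0, le_rfl⟩) hφ hx hε,
    eventually_lt_of_ae_hasDerivAt_le_neg (u := -fun t => x t i)
      (u' := fun t => C.dL (x t) (y t) i) (φ := fun t => -C.dL (x t) (y t) i)
      (fun T hT => (h.absCont_primal i T hT).neg)
      ((h.hasDeriv_primal i).mono fun t ht ht0 => ⟨by simpa using (ht ht0).neg, by simp⟩)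
      (h.uniformContinuousOn_comp hs (continuous_dL i).neg) hx.neg hε] with t h1 h2
  rw [Real.dist_eq, sub_zero, abs_lt]
  constructor <;> linarith

/-- The multiplier of a constraint that is inactive in the limit vanishes after finite time. -/
theorem IsTrajectory.tendsto_dual_of_inactive (h : C.IsTrajectory x y)
    (hx : Tendsto x atTop (𝓝 xs)) {j : J} (hj : C.g j xs < 0) :
    Tendsto (fun t => y t j) atTop (𝓝 0) := by
  have hev := (((C.continuous_g j).tendsto xs).comp hx).eventually
    (gt_mem_nhds (show C.g j xs < C.g j xs / 2 by linarith))
  obtain ⟨T, hT⟩ := eventually_atTop.1 (hev.and (eventually_ge_atTop 0))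
  have hT0 : 0 ≤ T := (hT T le_rfl).2
  have hac : ∀ s t, T ≤ s → s ≤ t → AbsolutelyContinuousOnInterval (fun t => y t j) s t :=
    fun s t hs hst => (h.absCont_dual j t (by linarith)).mono (by
      rw [uIcc_of_le hst, uIcc_of_le (by linarith)]
      exact Icc_subset_Icc_left (by linarith))
  have hmono : ∀ s t, T ≤ s → s ≤ t → y t j ≤ y s j := by
    intro s t hs hst
    have := (hac s t hs hst).sub_le_of_ae_hasDerivAt_le (C := 0) hst (by
      filter_upwards [h.hasDeriv_dual j] with r hr hrI
      refine ⟨hr (by linarith [hrI.1]), switchPlus_nonpos ?_⟩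
      have := (hT r (by linarith [hrI.1])).1
      simp only [Function.comp_apply] at this
      linarith)
    linarith
  obtain ⟨t₀, ht₀, hy₀⟩ : ∃ t₀, T ≤ t₀ ∧ y t₀ j ≤ 0 := by
    by_contra! hcon
    have hη : 0 < -(C.g j xs / 2) := by linarith
    set t₁ := T + (y T j + 1) / -(C.g j xs / 2)
    have hT₁ : T ≤ t₁ := le_add_of_nonneg_right
      (div_nonneg (by linarith [h.nonneg T hT0 j]) hη.le)
    have h1 := (hac T t₁ le_rfl hT₁).sub_le_of_ae_hasDerivAt_le (C := C.g j xs / 2) hT₁ (by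
      filter_upwards [h.hasDeriv_dual j] with r hr hrI
      refine ⟨hr (by linarith [hrI.1]), ?_⟩
      rw [switchPlus, if_pos (hcon r hrI.1.le)]
      exact (hT r hrI.1.le).1.le)
    have h2 : C.g j xs / 2 * (t₁ - T) = -(y T j + 1) := by
      simp only [t₁, add_sub_cancel_left]
      have := hj.ne
      field_simp
    have h3 := hcon t₁ hT₁
    linarith
  refine tendsto_const_nhds.congr' ?_
  filter_upwards [eventually_ge_atTop t₀] with t ht
  exact le_antisymm (h.nonneg t (by linarith) j) ((hmono t₀ t ht₀ ht).trans hy₀)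

/-- Every trajectory converges to a KKT point. -/
theorem IsTrajectory.exists_tendsto (h : C.IsTrajectory x y) (hs : C.IsSaddle xs ys)
    (hfeas : ∀ j, C.g j xs ≤ 0) :
    ∃ ys', C.IsKKT xs ys' ∧ Tendsto (fun t => sqDist xs ys' (x t) (y t)) atTop (𝓝 0) := by
  have hx := h.tendsto_primal hs
  obtain ⟨⟨x', ys'⟩, -, φ, hφ, hlim⟩ := (isCompact_closedBall (xs, ys)
    (√(sqDist xs ys (x 0) (y 0)))).tendsto_subseq (x := fun k : ℕ => (x k, y k))
    fun k => h.mem_closedBall hs k.cast_nonneg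
  have ht : Tendsto (fun k => (φ k : ℝ)) atTop atTop :=
    tendsto_natCast_atTop_atTop.comp hφ.tendsto_atTop
  obtain rfl : x' = xs :=
    tendsto_nhds_unique ((continuous_fst.tendsto _).comp hlim) (hx.comp ht)
  have hy : ∀ j, Tendsto (fun k => y (φ k) j) atTop (𝓝 (ys' j)) := fun j =>
    tendsto_pi_nhds.1 ((continuous_snd.tendsto _).comp hlim) j
  have hkkt : C.IsKKT x' ys' := by
    refine ⟨fun j => ge_of_tendsto' (hy j) fun k => h.nonneg _ (Nat.cast_nonneg _) j,
      fun i => ?_, hfeas, fun j => ?_⟩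
    · exact tendsto_nhds_unique (((continuous_dL (C := C) i).tendsto _).comp hlim)
        ((h.tendsto_dL hs i).comp ht)
    · rcases (hfeas j).lt_or_eq with hj | hj
      · rw [tendsto_nhds_unique (hy j) ((h.tendsto_dual_of_inactive hx hj).comp ht), zero_mul]
      · rw [hj, mul_zero]
  refine ⟨ys', hkkt, ?_⟩
  have hsub : Tendsto (fun k => sqDist x' ys' (x (φ k)) (y (φ k))) atTop (𝓝 0) := by
    have := ((continuous_sqDist x' ys').tendsto _).comp hlim
    simpa [sqDist, Function.comp_def] using this
  rw [Metric.tendsto_atTop]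
  intro ε hε
  obtain ⟨k, hk⟩ := (hsub.eventually (gt_mem_nhds hε)).exists
  refine ⟨φ k, fun t htk => ?_⟩
  rw [Real.dist_eq, sub_zero, abs_of_nonneg (sqDist_nonneg _ _ _ _)]
  exact (h.sqDist_le hkkt.isSaddle (Nat.cast_nonneg _) htk).trans_lt hk

/-- A convex function with continuous first-order minorants is differentiable; here the
Lagrangian in the primal variable. -/
theorem hasFDerivAt_L (x : ι → ℝ) {y : J → ℝ} (hy : ∀ j, 0 ≤ y j) :
    HasFDerivAt (fun x => C.L x y)
      (∑ i, C.dL x y i • (ContinuousLinearMap.proj i : (ι → ℝ) →L[ℝ] ℝ)) x := by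
  rw [hasFDerivAt_iff_isLittleO, Asymptotics.isLittleO_iff]
  intro ε hε
  have hcont : Tendsto (fun x' => ∑ i, |C.dL x' y i - C.dL x y i|) (𝓝 x) (𝓝 0) := by
    have : Continuous fun x' => ∑ i, |C.dL x' y i - C.dL x y i| := by
      have h1 : ∀ i, Continuous fun x' => C.dL x' y i := fun i =>
        (continuous_dL (C := C) i).comp (continuous_id.prodMk continuous_const)
      fun_prop
    simpa using this.tendsto x
  filter_upwards [hcont.eventually (gt_mem_nhds hε)] with x' hx'
  have hsq : ∀ u v : ι → ℝ, 0 ≤ C.modulus * ∑ i, (u i - v i) ^ 2 := fun u v =>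
    mul_nonneg C.modulus_pos.le (Finset.sum_nonneg fun _ _ => sq_nonneg _)
  have h1 := C.L_convex x x' hy
  have h2 := C.L_convex x' x hy
  have h3 : ∑ i, (C.dL x' y i - C.dL x y i) * (x' i - x i) ≤ ε * ‖x' - x‖ := by
    calc _ ≤ ∑ i, |C.dL x' y i - C.dL x y i| * ‖x' - x‖ := Finset.sum_le_sum fun i _ => by
          refine (le_abs_self _).trans ?_
          rw [abs_mul]
          exact mul_le_mul_of_nonneg_left (norm_le_pi_norm (x' - x) i) (abs_nonneg _)
      _ ≤ _ := by
          rw [← Finset.sum_mul]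
          exact mul_le_mul_of_nonneg_right hx'.le (norm_nonneg _)
  have h4 : ∑ i, C.dL x' y i * (x i - x' i) = -∑ i, C.dL x' y i * (x' i - x i) := by
    rw [← Finset.sum_neg_distrib]
    exact Finset.sum_congr rfl fun i _ => by ring
  simp only [sub_mul, Finset.sum_sub_distrib] at h3
  have h5 := mul_nonneg hε.le (norm_nonneg (x' - x))
  simp only [_root_.sum_apply, _root_.smul_apply,
    ContinuousLinearMap.proj_apply, smul_eq_mul, Pi.sub_apply]
  rw [Real.norm_eq_abs, abs_le]
  constructor <;> linarith [hsq x x', hsq x' x]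

end ConvexProgram

namespace PowerNetwork

variable {nb n : ℕ}

/-- Coordinates of the decision variables. -/
def primalCoord (P : Power nb) : Fin 2 × Fin nb → ℝ := fun q => P q.1 q.2

/-- Decision variables with given coordinates. -/
def ofPrimalCoord (x : Fin 2 × Fin nb → ℝ) : Power nb := fun k => WithLp.toLp 2 fun i => x (k, i)

@[simp] theorem primalCoord_ofPrimalCoord (x : Fin 2 × Fin nb → ℝ) :
    primalCoord (ofPrimalCoord x) = x := rfl

@[simp] theorem ofPrimalCoord_primalCoord (P : Power nb) :
    ofPrimalCoord (primalCoord P) = P := rfl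

theorem primalCoord_injective : Function.Injective (primalCoord (nb := nb)) :=
  Function.LeftInverse.injective ofPrimalCoord_primalCoord

variable (N : PowerNetwork nb n)

/-- The constraints: the transmission thresholds, the upper and the lower bounds. -/
abbrev Constraint : Type := N.Edge ⊕ (Fin 2 × Fin nb) ⊕ (Fin 2 × Fin nb)

/-- Coordinates of the multipliers. -/
def dualCoord (μ : N.Multiplier) : N.Constraint → ℝ :=
  Sum.elim μ.1 (Sum.elim (fun q => μ.2.1 q.1 q.2) fun q => μ.2.2 q.1 q.2)

/-- Multipliers with given coordinates. -/
def ofDualCoord (y : N.Constraint → ℝ) : N.Multiplier :=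
  (fun e => y (Sum.inl e), fun k i => y (Sum.inr (Sum.inl (k, i))),
    fun k i => y (Sum.inr (Sum.inr (k, i))))

@[simp] theorem dualCoord_ofDualCoord (y : N.Constraint → ℝ) :
    N.dualCoord (N.ofDualCoord y) = y := by
  funext j
  rcases j with e | q | q <;> rfl

theorem nonneg_iff_dualCoord (μ : N.Multiplier) : 0 ≤ μ ↔ ∀ j, 0 ≤ N.dualCoord μ j := by
  constructor
  · rintro ⟨h1, h2, h3⟩ (e | q | q)
    exacts [h1 e, h2 q.1 q.2, h3 q.1 q.2]
  · intro h
    exact ⟨fun e => h (Sum.inl e), fun k i => h (Sum.inr (Sum.inl (k, i))),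
      fun k i => h (Sum.inr (Sum.inr (k, i)))⟩

/-- The linearized transmission power in coordinates. -/
noncomputable def flow (m : ℕ) (e : N.Edge) (x : Fin 2 × Fin nb → ℝ) : ℝ :=
  ∑ q : Fin 2 × Fin nb, N.R m q.1 e.1.1 e.1.2 q.2 * x q - N.R m 0 e.1.1 e.1.2 ⬝ᵥ N.P0.ofLp

theorem Phat_eq_flow (m : ℕ) (e : N.Edge) (P : Power nb) :
    N.Phat m e.1.1 e.1.2 P = N.flow m e (primalCoord P) := by
  simp only [Phat, flow, Fintype.sum_prod_type, Fin.sum_univ_two, primalCoord, dotProduct,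
    WithLp.ofLp_sub, Pi.sub_apply, mul_sub, Finset.sum_sub_distrib]
  ring

theorem flow_sub_flow (m : ℕ) (e : N.Edge) (x x' : Fin 2 × Fin nb → ℝ) :
    N.flow m e x' - N.flow m e x =
      ∑ q : Fin 2 × Fin nb, N.R m q.1 e.1.1 e.1.2 q.2 * (x' q - x q) := by
  simp only [flow, mul_sub, Finset.sum_sub_distrib]
  ring

theorem continuous_flow (m : ℕ) (e : N.Edge) : Continuous (N.flow m e) := by
  unfold flow
  fun_prop

/-- The linearized two-step problem as a convex program in coordinates. -/
noncomputable def program (m : ℕ) (hW : ∀ i, N.W i ≠ 0) :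
    ConvexProgram (Fin 2 × Fin nb) N.Constraint where
  f x := ∑ q, N.W q.2 ^ 2 * (x q - N.P0 q.2) ^ 2
  df x q := 2 * N.W q.2 ^ 2 * (x q - N.P0 q.2)
  g := Sum.elim (fun e x => N.flow m e x ^ 2 - N.thr e.1.1 e.1.2 ^ 2)
    (Sum.elim (fun q x => x q - N.Phi q.2) fun q x => N.Plo q.2 - x q)
  dg := Sum.elim (fun e x q => 2 * N.flow m e x * N.R m q.1 e.1.1 e.1.2 q.2)
    (Sum.elim (fun q _ => Pi.single q 1) fun q _ => -Pi.single q 1)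
  modulus := (1 + ∑ i, (N.W i ^ 2)⁻¹)⁻¹
  modulus_pos := by positivity
  f_convex x x' := by
    rw [Finset.mul_sum, ← Finset.sum_add_distrib, ← Finset.sum_add_distrib]
    refine Finset.sum_le_sum fun q _ => ?_
    have hpos : 0 < N.W q.2 ^ 2 := by
      have := hW q.2
      positivity
    have hle : (1 + ∑ i, (N.W i ^ 2)⁻¹)⁻¹ ≤ N.W q.2 ^ 2 := by
      refine inv_le_of_inv_le₀ hpos ?_
      have := Finset.single_le_sum (f := fun i => (N.W i ^ 2)⁻¹)
        (fun i _ => by positivity) (Finset.mem_univ q.2)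
      linarith
    nlinarith [mul_le_mul_of_nonneg_right hle (sq_nonneg (x' q - x q))]
  g_convex j x x' := by
    rcases j with e | q | q
    · have h := N.flow_sub_flow m e x x'
      simp only [Sum.elim_inl, mul_assoc, ← Finset.mul_sum]
      rw [← h]
      nlinarith [sq_nonneg (N.flow m e x' - N.flow m e x)]
    · simp [Pi.single_apply]
    · simp [Pi.single_apply]
  continuous_df q := by fun_prop
  continuous_g j := by
    rcases j with e | q | q
    · exact ((N.continuous_flow m e).pow 2).sub continuous_const
    · exact (continuous_apply q).sub continuous_const
    · exact continuous_const.sub (continuous_apply q)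
  continuous_dg j q := by
    rcases j with e | p | p
    · exact (continuous_const.mul (N.continuous_flow m e)).mul continuous_const
    · exact continuous_const
    · exact continuous_const

variable {N} {m : ℕ} (hW : ∀ i, N.W i ≠ 0)

theorem cost_eq_program (P : Power nb) : N.cost P = (N.program m hW).f (primalCoord P) := by
  simp only [cost, program, EuclideanSpace.norm_sq_eq, Fintype.sum_prod_type, primalCoord,
    Real.norm_eq_abs, sq_abs, mul_pow]
  rfl

theorem mem_feasible_iff_program (P : Power nb) :
    P ∈ N.feasible m ↔ ∀ j, (N.program m hW).g j (primalCoord P) ≤ 0 := by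
  constructor
  · rintro ⟨h1, h2⟩ (e | q | q)
    · have := h1 e
      rw [Phat_eq_flow] at this
      exact sub_nonpos.2 this
    · exact sub_nonpos.2 (h2 q.1 q.2).2
    · exact sub_nonpos.2 (h2 q.1 q.2).1
  · intro h
    refine ⟨fun e => ?_, fun k i => ⟨?_, ?_⟩⟩
    · rw [Phat_eq_flow]
      exact sub_nonpos.1 (h (Sum.inl e))
    · exact sub_nonpos.1 (h (Sum.inr (Sum.inr (k, i))))
    · exact sub_nonpos.1 (h (Sum.inr (Sum.inl (k, i))))

theorem lagrangian_eq_program (P : Power nb) (μ : N.Multiplier) :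
    N.lagrangian m P μ = (N.program m hW).L (primalCoord P) (N.dualCoord μ) := by
  simp only [lagrangian, ConvexProgram.L, ← cost_eq_program, Fintype.sum_sum_type,
    Fintype.sum_prod_type, Phat_eq_flow]
  simp only [program, dualCoord, Sum.elim_inl, Sum.elim_inr, primalCoord]
  ring

theorem isSaddlePoint_iff_program (P : Power nb) (μ : N.Multiplier) :
    N.IsSaddlePoint m P μ ↔ (N.program m hW).IsSaddle (primalCoord P) (N.dualCoord μ) := by
  simp only [IsSaddlePoint, nonneg_iff_dualCoord, lagrangian_eq_program hW]
  constructor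
  · rintro ⟨h1, h2, h3⟩
    refine ⟨h1, fun x' => by simpa using h2 (ofPrimalCoord x'), fun y' hy' => ?_⟩
    simpa using h3 (N.ofDualCoord y') (by simpa using hy')
  · rintro ⟨h1, h2, h3⟩
    exact ⟨h1, fun Q => h2 _, fun ν hν => h3 _ hν⟩

/-- The gradient of the Lagrangian in one of the two power vectors. -/
theorem gradient_lagrangian (P : Power nb) {μ : N.Multiplier} (hμ : 0 ≤ μ) (k : Fin 2) :
    gradient (fun p => N.lagrangian m (Function.update P k p) μ) (P k) =
      WithLp.toLp 2 fun i => (N.program m hW).dL (primalCoord P) (N.dualCoord μ) (k, i) := by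
  refine HasGradientAt.gradient ?_
  rw [hasGradientAt_iff_hasFDerivAt]
  simp only [lagrangian_eq_program hW]
  let emb : EuclideanSpace ℝ (Fin nb) →L[ℝ] (Fin 2 × Fin nb → ℝ) :=
    ContinuousLinearMap.pi fun q => if q.1 = k then EuclideanSpace.proj q.2 else 0
  have hemb : (fun p => primalCoord (Function.update P k p)) =
      fun p => primalCoord (Function.update P k 0) + emb p := by
    funext p ⟨l, i⟩
    by_cases hl : l = k
    · subst hl
      simp [primalCoord, emb]
    · simp [primalCoord, emb, hl]
  have h1 : HasFDerivAt (fun p => primalCoord (Function.update P k p)) emb (P k) := by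
    rw [hemb]
    exact emb.hasFDerivAt.const_add _
  have h2 := ConvexProgram.hasFDerivAt_L (C := N.program m hW)
    (primalCoord (Function.update P k (P k))) ((N.nonneg_iff_dualCoord μ).1 hμ)
  refine (h2.comp (P k) h1).congr_fderiv ?_
  ext v
  rw [Function.update_eq_self]
  simp [emb, Fintype.sum_prod_type, PiLp.inner_apply, Fin.sum_univ_two]
  fin_cases k <;> simp [mul_comm]

theorem IsSolution.isTrajectory {z : ℝ → N.State} (hz : N.IsSolution m z) :
    (N.program m hW).IsTrajectory (fun t => primalCoord (z t).1)
      (fun t => N.dualCoord (z t).2) := by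
  have hac : ∀ (ℓ : N.State →L[ℝ] ℝ) (T : ℝ), 0 ≤ T →
      AbsolutelyContinuousOnInterval (fun t => ℓ (z t)) 0 T := fun ℓ T hT =>
    (hz.absCont T hT).lipschitz_comp ℓ.lipschitz
  have hd : ∀ ℓ : N.State →L[ℝ] ℝ, ∀ᵐ t ∂volume, 0 < t →
      HasDerivAt (fun t => ℓ (z t)) (ℓ (N.field m (z t))) t := fun ℓ =>
    hz.hasDeriv.mono fun t ht ht0 => ℓ.hasFDerivAt.comp_hasDerivAt t (ht ht0)
  let primal : Fin 2 × Fin nb → N.State →L[ℝ] ℝ := fun q =>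
    (EuclideanSpace.proj q.2).comp ((ContinuousLinearMap.proj q.1).comp
      (ContinuousLinearMap.fst ℝ (Power nb) N.Multiplier))
  let dual : N.Constraint → N.State →L[ℝ] ℝ := Sum.elim
    (fun e => (ContinuousLinearMap.proj e).comp ((ContinuousLinearMap.fst ℝ (N.Edge → ℝ) _).comp
      (ContinuousLinearMap.snd ℝ (Power nb) N.Multiplier)))
    (Sum.elim
      (fun q => (ContinuousLinearMap.proj q.2).comp ((ContinuousLinearMap.proj q.1).comp
        ((ContinuousLinearMap.fst ℝ _ _).comp ((ContinuousLinearMap.snd ℝ (N.Edge → ℝ) _).comp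
          (ContinuousLinearMap.snd ℝ (Power nb) N.Multiplier)))))
      (fun q => (ContinuousLinearMap.proj q.2).comp ((ContinuousLinearMap.proj q.1).comp
        ((ContinuousLinearMap.snd ℝ _ _).comp ((ContinuousLinearMap.snd ℝ (N.Edge → ℝ) _).comp
          (ContinuousLinearMap.snd ℝ (Power nb) N.Multiplier))))))
  refine ⟨fun q => hac (primal q), fun j => ?_,
    fun t ht => (N.nonneg_iff_dualCoord _).1 (hz.nonneg t ht), fun q => ?_, fun j => ?_⟩
  · rcases j with e | q | q
    exacts [hac (dual (Sum.inl e)), hac (dual (Sum.inr (Sum.inl q))),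
      hac (dual (Sum.inr (Sum.inr q)))]
  · refine (hd (primal q)).mono fun t ht ht0 => (ht ht0).congr_deriv ?_
    simp [primal, field, gradient_lagrangian hW (z t).1 (hz.nonneg t ht0.le)]
  · rcases j with e | q | q
    · refine (hd (dual (Sum.inl e))).mono fun t ht ht0 => (ht ht0).congr_deriv ?_
      simp [dual, field, Phat_eq_flow, program, dualCoord]
    · exact hd (dual (Sum.inr (Sum.inl q)))
    · exact hd (dual (Sum.inr (Sum.inr q)))

/-- At a minimizer of the linearized two-step problem there are Karush-Kuhn-Tucker multipliers. -/
theorem exists_isKKT_program (hthr : ∀ e : N.Edge, 0 < N.thr e.1.1 e.1.2)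
    {x : Fin 2 × Fin nb → ℝ} (hx : ∀ j, (N.program m hW).g j x ≤ 0)
    (hmin : ∀ x', (∀ j, (N.program m hW).g j x' ≤ 0) →
      (N.program m hW).f x ≤ (N.program m hW).f x') :
    ∃ y, (N.program m hW).IsKKT x y := by
  refine ConvexProgram.exists_isKKT hx hmin fun j hj d hd => ?_
  rcases j with e | q | q
  · set ρ := ∑ q : Fin 2 × Fin nb, N.R m q.1 e.1.1 e.1.2 q.2 * d q with hρ
    have hflow : ∀ t : ℝ, N.flow m e (fun q => x q + t * d q) = N.flow m e x + t * ρ := by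
      intro t
      rw [← sub_eq_iff_eq_add', flow_sub_flow, hρ, Finset.mul_sum]
      exact Finset.sum_congr rfl fun q _ => by ring
    have hact : N.flow m e x ^ 2 = N.thr e.1.1 e.1.2 ^ 2 := sub_eq_zero.1 hj
    have hne : N.flow m e x ≠ 0 := by
      intro h0
      rw [h0] at hact
      nlinarith [hthr e]
    have hdir : N.flow m e x * ρ ≤ 0 := by
      simp only [program, Sum.elim_inl, mul_assoc, ← Finset.mul_sum] at hd
      linarith
    have hg : ∀ t : ℝ, (N.program m hW).g (Sum.inl e) (fun q => x q + t * d q) =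
        t * (2 * (N.flow m e x * ρ) + t * ρ ^ 2) := by
      intro t
      simp only [program, Sum.elim_inl, hflow, ← hact]
      ring
    simp only [hg]
    rcases eq_or_ne ρ 0 with h0 | h0
    · simp [h0]
    · have hlt : N.flow m e x * ρ < 0 := lt_of_le_of_ne hdir (mul_ne_zero hne h0)
      have hlim : Tendsto (fun t : ℝ => 2 * (N.flow m e x * ρ) + t * ρ ^ 2) (𝓝 0)
          (𝓝 (2 * (N.flow m e x * ρ))) := by
        have : Continuous fun t : ℝ => 2 * (N.flow m e x * ρ) + t * ρ ^ 2 := by fun_prop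
        simpa using this.tendsto 0
      filter_upwards [self_mem_nhdsWithin, nhdsWithin_le_nhds
        (hlim.eventually (gt_mem_nhds (show 2 * (N.flow m e x * ρ) < 0 by linarith)))] with t ht0 ht
      exact mul_nonpos_of_nonneg_of_nonpos (le_of_lt ht0) (le_of_lt ht)
  · have hd' : d q ≤ 0 := by simpa [program, Pi.single_apply] using hd
    have hj' : x q - N.Phi q.2 = 0 := hj
    filter_upwards [self_mem_nhdsWithin] with t ht
    have := mul_nonpos_of_nonneg_of_nonpos (le_of_lt ht) hd'
    simp only [program, Sum.elim_inl, Sum.elim_inr]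
    linarith
  · have hd' : 0 ≤ d q := by simpa [program, Pi.single_apply] using hd
    have hj' : N.Plo q.2 - x q = 0 := hj
    filter_upwards [self_mem_nhdsWithin] with t ht
    have := mul_nonneg (le_of_lt ht) hd'
    simp only [program, Sum.elim_inr]
    linarith

theorem exists_isOptimal (hW : ∀ i, N.W i ≠ 0) (hfeas : (N.feasible m).Nonempty) :
    ∃ P, N.IsOptimal m P := by
  have hclosed : IsClosed {x | ∀ j, (N.program m hW).g j x ≤ 0} := by
    simp only [ofPred_forall]
    exact isClosed_iInter fun j => isClosed_le ((N.program m hW).continuous_g j) continuous_const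
  have hcompact : IsCompact {x | ∀ j, (N.program m hW).g j x ≤ 0} := by
    refine (isCompact_Icc (a := fun q : Fin 2 × Fin nb => N.Plo q.2)
      (b := fun q => N.Phi q.2)).of_isClosed_subset hclosed fun x hx => ⟨fun q => ?_, fun q => ?_⟩
    · exact sub_nonpos.1 (hx (Sum.inr (Sum.inr q)))
    · exact sub_nonpos.1 (hx (Sum.inr (Sum.inl q)))
  have hcont : Continuous (N.program m hW).f := by
    simp only [program]
    fun_prop
  obtain ⟨Q, hQ⟩ := hfeas
  obtain ⟨x, hx, hmin⟩ := hcompact.exists_isMinOn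
    ⟨primalCoord Q, (mem_feasible_iff_program hW Q).1 hQ⟩ hcont.continuousOn
  refine ⟨ofPrimalCoord x, (mem_feasible_iff_program hW _).2 hx, fun P hP => ?_⟩
  rw [cost_eq_program (m := m) hW, cost_eq_program (m := m) hW]
  exact hmin ((mem_feasible_iff_program hW P).1 hP)

theorem dist_le_sqrt_sqDist (z w : N.State) :
    dist z w ≤ √(ConvexProgram.sqDist (primalCoord w.1) (N.dualCoord w.2) (primalCoord z.1)
      (N.dualCoord z.2)) := by
  set S := ConvexProgram.sqDist (primalCoord w.1) (N.dualCoord w.2) (primalCoord z.1)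
      (N.dualCoord z.2)
  have h0 := Real.sqrt_nonneg S
  have hdual : ∀ j, dist (N.dualCoord z.2 j) (N.dualCoord w.2 j) ≤ √S := fun j =>
    Real.abs_le_sqrt (ConvexProgram.sq_sub_le_sqDist_right _ _ _ _ j)
  rw [Prod.dist_eq, Prod.dist_eq (x := z.2), Prod.dist_eq (x := z.2.2)]
  refine max_le ((dist_pi_le_iff h0).2 fun k => ?_) (max_le ((dist_pi_le_iff h0).2 fun e => ?_)
    (max_le ((dist_pi_le_iff h0).2 fun k => (dist_pi_le_iff h0).2 fun i => ?_)
      ((dist_pi_le_iff h0).2 fun k => (dist_pi_le_iff h0).2 fun i => ?_)))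
  · rw [EuclideanSpace.dist_eq]
    refine Real.sqrt_le_sqrt ?_
    simp only [Real.dist_eq, sq_abs]
    refine le_trans ?_ (le_add_of_nonneg_right (Finset.sum_nonneg fun _ _ => sq_nonneg _))
    rw [Fintype.sum_prod_type]
    exact Finset.single_le_sum
      (f := fun k => ∑ i, (primalCoord z.1 (k, i) - primalCoord w.1 (k, i)) ^ 2)
      (fun _ _ => Finset.sum_nonneg fun _ _ => sq_nonneg _) (Finset.mem_univ k)
  · exact hdual (Sum.inl e)
  · exact hdual (Sum.inr (Sum.inl (k, i)))
  · exact hdual (Sum.inr (Sum.inr (k, i)))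

theorem continuous_sqDist_coord (w : N.State) :
    Continuous fun z : N.State => ConvexProgram.sqDist (primalCoord w.1) (N.dualCoord w.2)
      (primalCoord z.1) (N.dualCoord z.2) := by
  refine (ConvexProgram.continuous_sqDist (primalCoord w.1) (N.dualCoord w.2)).comp
    (Continuous.prodMk ?_ ?_)
  · refine continuous_pi fun q => ?_
    change Continuous fun z : N.State => z.1 q.1 q.2
    fun_prop
  · refine continuous_pi fun j => ?_
    rcases j with e | q | q <;> simp only [Sum.elim_inl, Sum.elim_inr] <;> fun_prop

end PowerNetwork

theorem proposition7 {nb n : ℕ} (N : PowerNetwork nb n) (m : ℕ) (hm : 2 ≤ m)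
    (hW : ∀ i, N.W i ≠ 0)
    (hthr : ∀ e : N.Edge, 0 < N.thr e.1.1 e.1.2)
    (hfeas : (N.feasible m).Nonempty) :
    ∃ Pstar : PowerNetwork.Power nb,
      (∀ P, N.IsOptimal m P ↔ P = Pstar) ∧
      (∃ μ, N.IsSaddlePoint m Pstar μ) ∧
      (∀ μ, N.IsSaddlePoint m Pstar μ → ∀ ε > 0, ∃ δ > 0, ∀ z, N.IsSolution m z →
        dist (z 0) (Pstar, μ) < δ → ∀ t, 0 ≤ t → dist (z t) (Pstar, μ) < ε) ∧
      ∀ z, N.IsSolution m z →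
        ∃ μ, N.IsSaddlePoint m Pstar μ ∧ Tendsto z atTop (𝓝 (Pstar, μ)) := by
  obtain ⟨Pstar, hopt⟩ := PowerNetwork.exists_isOptimal hW hfeas
  have hfeasible := (PowerNetwork.mem_feasible_iff_program hW Pstar).1 hopt.1
  obtain ⟨y, hy⟩ := PowerNetwork.exists_isKKT_program hW hthr hfeasible fun x' hx' => by
    have := hopt.2 (PowerNetwork.ofPrimalCoord x')
      ((PowerNetwork.mem_feasible_iff_program hW _).2 hx')
    rwa [PowerNetwork.cost_eq_program (m := m) hW, PowerNetwork.cost_eq_program (m := m) hW] at this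
  refine ⟨Pstar, fun P => ⟨fun hP => ?_, fun hP => hP ▸ hopt⟩, ⟨N.ofDualCoord y, ?_⟩,
    fun μ hμ ε hε => ?_, fun z hz => ?_⟩
  · refine PowerNetwork.primalCoord_injective (hy.eq_of_le
      ((PowerNetwork.mem_feasible_iff_program hW P).1 hP.1) ?_)
    rw [← PowerNetwork.cost_eq_program, ← PowerNetwork.cost_eq_program]
    exact hP.2 Pstar hopt.1
  · rw [PowerNetwork.isSaddlePoint_iff_program hW, PowerNetwork.dualCoord_ofDualCoord]
    exact hy.isSaddle
  · have hlim := (PowerNetwork.continuous_sqDist_coord (N := N) (Pstar, μ)).tendsto (Pstar, μ)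
    simp only [ConvexProgram.sqDist, sub_self, ne_eq, OfNat.ofNat_ne_zero, not_false_eq_true,
      zero_pow, Finset.sum_const_zero, add_zero] at hlim
    obtain ⟨δ, hδ, hball⟩ := Metric.eventually_nhds_iff.1
      (hlim.eventually (gt_mem_nhds (show 0 < ε ^ 2 by positivity)))
    refine ⟨δ, hδ, fun z hz hz0 t ht => ?_⟩
    refine (PowerNetwork.dist_le_sqrt_sqDist _ _).trans_lt ((Real.sqrt_lt' hε).2 ?_)
    exact ((hz.isTrajectory hW).sqDist_le ((PowerNetwork.isSaddlePoint_iff_program hW _ _).1 hμ)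
      le_rfl ht).trans_lt (hball hz0)
  · obtain ⟨ys, hys, hlim⟩ := (hz.isTrajectory hW).exists_tendsto hy.isSaddle hfeasible
    refine ⟨N.ofDualCoord ys, ?_, ?_⟩
    · rw [PowerNetwork.isSaddlePoint_iff_program hW, PowerNetwork.dualCoord_ofDualCoord]
      exact hys.isSaddle
    · rw [tendsto_iff_dist_tendsto_zero]
      refine squeeze_zero (fun _ => dist_nonneg)
        (fun t => PowerNetwork.dist_le_sqrt_sqDist (z t) (Pstar, N.ofDualCoord ys)) ?_
      simp only [PowerNetwork.dualCoord_ofDualCoord]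
      simpa using hlim.sqrt
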